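/- Fix integers $n,d\ge 1$ and let $\mathbb N^n_d=\{c\in\mathbb Z_{\ge 0}^n : c_1+\dots+c_n=d\}$. For $a\in\mathbb Z^n$ put $m(a)=\max(\{i: a_i\neq 0\}\cup\{1\})$ and $\mu(a)=\min(\{i: a_i\ne 0\}\cup\{n\})$. For $a,b\in\mathbb N^n_d$ write $a>_{\mathrm{hlex}}b$ if $a_{\mu(a-b)}>b_{\mu(a-b)}$, and $a\ge_{\mathrm{Bor}}b$ if $a-b=\sum_{j=1}^{n-1}\alpha_j(e_j-e_{j+1})$ with all $\alpha_j\in\mathbb Z_{\ge 0}$. A set $B\subseteq\mathbb N^n_d$ is a Borel set if $a\in B$, $b\in\mathbb N^n_d$ and $b\ge_{\mathrm{Bor}}a$ imply $b\in B$. A subset $A\subseteq B$ is a lexicographic segment of $B$ if $a\in A$, $b\in B$ and $b>_{\mathrm{hlex}}a$ imply $b\in A$. For $A\subseteq\mathbb N^n_d$ let $A^{(i)}=\{c\in A: m(c)=i\}$ and $A(i)=\{c\in A: c_n=i\}$. The growth vector of $A$ is $(\#A^{(1)},\dots,\#A^{(n)})$ and the height vector is $(\#A(1),\dots,\#A(d))$.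 A Borel set $B$ is growth-height-lexicographic if $B^{(i)}$ is a lexicographic segment of $(\mathbb N^n_d)^{(i)}$ for $1\le i<n$ and $B(i)$ is a lexicographic segment of $\mathbb N^n_d(i)$ for $1\le i\le d$. A binomial system is a triple $(A,C,\rho)$ with $A,C\subseteq\mathbb N^n_d$ and $\rho\in\mathbb Z^n$ such that $C+\rho\subseteq\mathbb N^n_d$, the sets $A$, $C$, $C+\rho$ are pairwise disjoint, and $A\cup C$ and $A\cup(C+\rho)$ are Borel sets. It is Mall if (a) $C=\emptyset$ or $\rho_{m(\rho)}>0$; (b) $b_i=c_i$ for all $b,c\in C$ and $1\le i<m(\rho)$; (c) $\rho_{\mu(\rho)}>0$; (d) $m(c)=m(c+\rho)$ for all $c\in C$. Proposition. Let $B\subseteq\mathbb N^n_d$ be a Borel set. There is a unique growth-height-lexicographic Borel set $L_{gh}(B)\subseteq\mathbb N^n_d$ with the same growth vector and the same height vector as $B$ (its growth-height-lexicographic normal form). If $B\neq L_{gh}(B)$, then there are $r\ge 1$ and Mall binomial systems $(A_1,C_1,\rho_1),\dots,(A_r,C_r,\rho_r)$ such that (i) $B=A_1\cup C_1$; (ii)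 $A_i\cup(C_i+\rho_i)=A_{i+1}\cup C_{i+1}$ for $1\le i<r$; (iii) $L_{gh}(B)=A_r\cup(C_r+\rho_r)$; (iv) $m(\rho_i)<n$ for $1\le i\le r$. -/

import Mathlib

/-!  Points of `ℕⁿ` are regarded as points of `ℤⁿ = Fin n → ℤ` with nonnegative coordinates.  The
indices `1, …, n` are the elements of `Fin n`, so `⊥` is the first and `⊤` is the last one. -/

namespace BorelSets

section

variable {n : ℕ}

/-- The set of all vectors in `ℕⁿ` whose coordinates add up to `d`. -/
def degSet (n d : ℕ) : Set (Fin n → ℤ) :=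
  {c | (∀ i, 0 ≤ c i) ∧ ∑ i, c i = (d : ℤ)}

/-- There are only finitely many vectors of a given degree, so that the cardinalities below are
honest. -/
theorem degSet_finite (n d : ℕ) : (degSet n d).Finite := by
  refine (Set.finite_Icc (0 : Fin n → ℤ) (fun _ => (d : ℤ))).subset ?_
  rintro c ⟨h0, h1⟩
  refine ⟨fun i => h0 i, fun i => ?_⟩
  rw [← h1]
  exact Finset.single_le_sum (fun j _ => h0 j) (Finset.mem_univ i)

/-- `m(a)`: the largest index of a nonzero coordinate, and the first index if `a = 0`. -/
noncomputable def maxIdx [NeZero n] (a : Fin n → ℤ) : Fin n :=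
  (Finset.univ.filter fun i => a i ≠ 0).sup id

/-- `μ(a)`: the smallest index of a nonzero coordinate, and the last index if `a = 0`. -/
noncomputable def minIdx [NeZero n] (a : Fin n → ℤ) : Fin n :=
  (Finset.univ.filter fun i => a i ≠ 0).inf id

/-- `a >_hlex b` for the homogeneous lexicographic order. -/
def HlexGT [NeZero n] (a b : Fin n → ℤ) : Prop :=
  ∑ i, b i < ∑ i, a i ∨
    (∑ i, a i = ∑ i, b i ∧ b (minIdx (a - b)) < a (minIdx (a - b)))

/-- The standard vectors, indexed by natural numbers: `stdVec n j` is `1` in place `j`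
(counted from `0`). -/
def stdVec (n j : ℕ) : Fin n → ℤ := fun i => if (i : ℕ) = j then 1 else 0

/-- `a ≥_Bor b` for the Borel order: `a - b` is a combination of the differences
`e_j - e_{j+1}` of consecutive standard vectors with coefficients in `ℕ`. -/
def BorelGE (a b : Fin n → ℤ) : Prop :=
  ∃ α : ℕ → ℕ, a - b = ∑ j ∈ Finset.range (n - 1), α j • (stdVec n j - stdVec n (j + 1))

/-- `A` is a Borel set of degree `d`. -/
def IsBorel (d : ℕ) (A : Set (Fin n → ℤ)) : Prop :=
  A ⊆ degSet n d ∧ ∀ a ∈ A, ∀ b ∈ degSet n d, BorelGE b a → b ∈ A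

/-- `A` is a lexicographic segment of `B`. -/
def IsLexSegment [NeZero n] (A B : Set (Fin n → ℤ)) : Prop :=
  A ⊆ B ∧ ∀ a ∈ A, ∀ b ∈ B, HlexGT b a → b ∈ A

/-- `A^{(i)}`: the elements `c` of `A` with `m(c) = i`. -/
def growthPart [NeZero n] (A : Set (Fin n → ℤ)) (i : Fin n) : Set (Fin n → ℤ) :=
  {c ∈ A | maxIdx c = i}

/-- `A(i)`: the elements `c` of `A` with last coordinate `i`. -/
def heightPart [NeZero n] (A : Set (Fin n → ℤ)) (i : ℕ) : Set (Fin n → ℤ) :=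
  {c ∈ A | c ⊤ = (i : ℤ)}

/-- `B` is growth-height-lexicographic (for a Borel set `B` of degree `d`). -/
def IsGrowthHeightLex [NeZero n] (d : ℕ) (B : Set (Fin n → ℤ)) : Prop :=
  (∀ i : Fin n, i < ⊤ → IsLexSegment (growthPart B i) (growthPart (degSet n d) i)) ∧
  (∀ i : ℕ, 1 ≤ i → i ≤ d → IsLexSegment (heightPart B i) (heightPart (degSet n d) i))

/-- The growth vector `(#B^{(1)}, …, #B^{(n)})`. -/
noncomputable def growthVec [NeZero n] (B : Set (Fin n → ℤ)) : Fin n → ℕ :=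
  fun i => (growthPart B i).ncard

/-- The height vector `(#B(1), …, #B(d))`. -/
noncomputable def heightVec [NeZero n] (d : ℕ) (B : Set (Fin n → ℤ)) : Fin d → ℕ :=
  fun i => (heightPart B ((i : ℕ) + 1)).ncard

/-- `L` is a growth-height-lexicographic normal form of `B`: a growth-height-lexicographic Borel
set of degree `d` with the same growth and height vectors as `B`. -/
def IsNormalForm [NeZero n] (d : ℕ) (B L : Set (Fin n → ℤ)) : Prop :=
  IsBorel d L ∧ IsGrowthHeightLex d L ∧
    growthVec L = growthVec B ∧ heightVec d L = heightVec d B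

/-- The translate `C + ρ`. -/
def translate (C : Set (Fin n → ℤ)) (ρ : Fin n → ℤ) : Set (Fin n → ℤ) :=
  (fun c => c + ρ) '' C

/-- `(A, C, ρ)` is a binomial system of degree `d` in `n` indeterminates. -/
structure IsBinomialSystem (d : ℕ) (A C : Set (Fin n → ℤ)) (ρ : Fin n → ℤ) : Prop where
  left_subset : A ⊆ degSet n d
  right_subset : C ⊆ degSet n d
  translate_subset : translate C ρ ⊆ degSet n d
  inter_right : A ∩ C = ∅
  inter_translate : A ∩ translate C ρ = ∅
  right_inter_translate : C ∩ translate C ρ = ∅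
  borel_right : IsBorel d (A ∪ C)
  borel_translate : IsBorel d (A ∪ translate C ρ)

/-- The binomial system `(A, C, ρ)` is admissible. -/
structure IsAdmissible [NeZero n] (d : ℕ) (A C : Set (Fin n → ℤ)) (ρ : Fin n → ℤ) : Prop
    extends IsBinomialSystem d A C ρ where
  eq_empty_or_pos : C = ∅ ∨ 0 < ρ (maxIdx ρ)

/-- The binomial system `(A, C, ρ)` is good. -/
structure IsGood [NeZero n] (d : ℕ) (A C : Set (Fin n → ℤ)) (ρ : Fin n → ℤ) : Prop
    extends IsAdmissible d A C ρ where
  eq_of_lt : ∀ i : Fin n, i < maxIdx ρ → ∀ b ∈ C, ∀ c ∈ C, b i = c i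

/-- The binomial system `(A, C, ρ)` is Mall. -/
structure IsMall [NeZero n] (d : ℕ) (A C : Set (Fin n → ℤ)) (ρ : Fin n → ℤ) : Prop
    extends IsGood d A C ρ where
  minIdx_pos : 0 < ρ (minIdx ρ)
  maxIdx_eq : ∀ c ∈ C, maxIdx c = maxIdx (c + ρ)

end

end BorelSets

/-!
In degree `d` the Borel order compares the partial sums `c_1 + ... + c_i` (`borelGE_iff`), and
`m(c) ≥ i` says that the partial sum before place `i` is less than `d` (`psum_lt_iff`). The
argument is phrased in terms of partial sums throughout. Its one construction is `glue w x y`, the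
vector with the beginning of `x` and the end of `y`, whose partial sums are those of `x` up to `w`
and those of `y` beyond.

A growth-height-lexicographic set is determined by its two vectors, because a lexicographic segment
of a finite totally ordered set is determined by its cardinality (`IsNormalForm.unique`). Existence
and the chain of binomial systems both come from one construction: a Borel set `B` that is not
growth-height-lexicographic is the source of a Mall binomial system with nonempty `C` and
`m(ρ) < n`. Passing to the target keeps both vectors, and it replaces the elements of `C` by
lexicographically larger ones, so repeating this ends at the normal form (`exists_isNormalForm`).

For the construction, call `(a, b)` with `a ∈ B`, `b ∉ B`, `m(a) = m(b)` and `b` lexicographically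
larger than `a` a bad pair at `k` if `a` and `b` agree after place `k`. Choose `k` minimal such
that there is a bad pair at `k`. Minimality, which is `IsPrefixLex d B k`, has a strong consequence
(`IsPrefixLex.mem_of_psum_le`): if `x ∈ B`, `y` is lexicographically larger than `x`,
`m(y) ≤ m(x)`, and the partial sums of `y` are at least those of `x` from just before place `k` on,
then `y ∈ B`. So in each bad pair at `k` the sum of the coordinates before `k` drops, and `b - a`
is positive in place `k` (`IsBadPair.psum_lt`). Now take a bad pair at `k` for which the beginning
of `a`, i.e. its part before place `k`, is lexicographically minimal and then the beginning of `b`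
is maximal. With `ρ = b - a`, let `C` consist of the `c ∈ B` that begin like `a` and satisfy
`c + ρ ∉ B`. If replacing `C` by `C + ρ` destroyed the Borel property, the consequence of
minimality and gluing would give a bad pair at `k` with a smaller beginning of `a`, or with the
same one and a larger beginning of `b` (`exists_isMall_of_not_isPrefixLex`).
-/

namespace BorelSets

section

variable {n : ℕ}

/-! ### Partial sums and the Borel order -/

/-- The partial sum of the coordinates of `a` whose index, counted from `0`, is less than `i`. -/
def psum (a : Fin n → ℤ) (i : ℕ) : ℤ := ∑ j ∈ Finset.univ.filter (fun j : Fin n => (j : ℕ) < i), a j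

theorem psum_zero (a : Fin n → ℤ) : psum a 0 = 0 := by simp [psum]

theorem psum_of_le (a : Fin n → ℤ) {i : ℕ} (hi : n ≤ i) : psum a i = ∑ j, a j := by
  unfold psum
  rw [Finset.filter_true_of_mem]
  intro j _
  exact j.2.trans_le hi

theorem psum_succ (a : Fin n → ℤ) (j : Fin n) : psum a (j + 1) = psum a j + a j := by
  unfold psum
  have : Finset.univ.filter (fun i : Fin n => (i : ℕ) < j + 1) =
      insert j (Finset.univ.filter (fun i : Fin n => (i : ℕ) < j)) := by
    ext i
    simp only [Finset.mem_filter, Finset.mem_univ, true_and, Finset.mem_insert, Fin.ext_iff]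
    omega
  rw [this, Finset.sum_insert (by simp), add_comm]

theorem psum_add (a b : Fin n → ℤ) (i : ℕ) : psum (a + b) i = psum a i + psum b i := by
  simp [psum, Finset.sum_add_distrib]

theorem psum_sub (a b : Fin n → ℤ) (i : ℕ) : psum (a - b) i = psum a i - psum b i := by
  simp [psum, Finset.sum_sub_distrib]

theorem psum_mono {a : Fin n → ℤ} (ha : ∀ i, 0 ≤ a i) {i j : ℕ} (hij : i ≤ j) :
    psum a i ≤ psum a j := by
  unfold psum
  refine Finset.sum_le_sum_of_subset_of_nonneg (fun l hl => ?_) (fun l _ _ => ha l)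
  simp only [Finset.mem_filter, Finset.mem_univ, true_and] at hl ⊢
  omega

theorem psum_congr {a b : Fin n → ℤ} {k : ℕ} (h : ∀ i : Fin n, (i : ℕ) < k → a i = b i) {i : ℕ}
    (hi : i ≤ k) : psum a i = psum b i := by
  unfold psum
  refine Finset.sum_congr rfl fun j hj => h j ?_
  simp only [Finset.mem_filter, Finset.mem_univ, true_and] at hj
  omega

theorem eq_of_psum_eq {a b : Fin n → ℤ} (h : ∀ i, i ≤ n → psum a i = psum b i) : a = b := by
  funext j
  have h1 := psum_succ a j
  have h2 := psum_succ b j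
  have h3 := h j j.2.le
  have h4 := h (j + 1) j.2
  linarith

theorem psum_stdVec_sub {j : ℕ} (hj : j + 1 < n) (i : ℕ) :
    psum (stdVec n j - stdVec n (j + 1)) i = if i = j + 1 then 1 else 0 := by
  have key : ∀ l, l < n → psum (stdVec n l) i = if l < i then 1 else 0 := by
    intro l hl
    unfold psum stdVec
    rw [Finset.sum_ite, Finset.sum_const_zero, add_zero, Finset.sum_const]
    split_ifs with h
    · rw [Finset.card_eq_one.2 ⟨⟨l, hl⟩, ?_⟩]
      · simp
      · ext x
        simp only [Finset.mem_filter, Finset.mem_univ, true_and, Finset.mem_singleton, Fin.ext_iff]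
        omega
    · rw [Finset.card_eq_zero.2]
      · simp
      · ext x
        simp only [Finset.mem_filter, Finset.mem_univ, true_and, Finset.notMem_empty, iff_false]
        omega
  rw [psum_sub, key j (by omega), key (j + 1) hj]
  split_ifs <;> omega

theorem psum_sum_stdVec_sub (α : ℕ → ℕ) (i : ℕ) :
    psum (∑ j ∈ Finset.range (n - 1), α j • (stdVec n j - stdVec n (j + 1))) i =
      ∑ j ∈ Finset.range (n - 1), if i = j + 1 then (α j : ℤ) else 0 := by
  have : psum (∑ j ∈ Finset.range (n - 1), α j • (stdVec n j - stdVec n (j + 1))) i =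
      ∑ j ∈ Finset.range (n - 1), (α j : ℤ) * psum (stdVec n j - stdVec n (j + 1)) i := by
    unfold psum
    simp only [Finset.sum_apply, nsmul_eq_mul, Finset.mul_sum]
    exact Finset.sum_comm
  rw [this]
  refine Finset.sum_congr rfl fun j hj => ?_
  rw [Finset.mem_range] at hj
  rw [psum_stdVec_sub (by omega)]
  simp

/-- The Borel order is the dominance order: it compares the partial sums. -/
theorem borelGE_iff {d : ℕ} {a b : Fin n → ℤ} (ha : a ∈ degSet n d) (hb : b ∈ degSet n d) :
    BorelGE b a ↔ ∀ i, psum a i ≤ psum b i := by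
  constructor
  · rintro ⟨α, h⟩ i
    have := psum_sum_stdVec_sub (n := n) α i
    rw [← h, psum_sub] at this
    have h0 : 0 ≤ ∑ j ∈ Finset.range (n - 1), if i = j + 1 then (α j : ℤ) else 0 :=
      Finset.sum_nonneg fun j _ => by split_ifs <;> simp
    linarith
  · intro h
    refine ⟨fun j => (psum (b - a) (j + 1)).toNat, eq_of_psum_eq fun i hi => ?_⟩
    rw [psum_sum_stdVec_sub]
    rcases Nat.eq_zero_or_pos i with rfl | h0
    · simp [psum_zero]
    · obtain ⟨j, rfl⟩ := Nat.exists_eq_succ_of_ne_zero h0.ne'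
      rcases Nat.lt_or_ge j (n - 1) with hj | hj
      · rw [Finset.sum_eq_single j]
        · have := h (j + 1)
          rw [← sub_nonneg, ← psum_sub] at this
          simp [this]
        · intro l _ hl
          rw [if_neg (by omega)]
        · simp [hj]
      · rw [Finset.sum_eq_zero, psum_sub, psum_of_le _ (by omega), psum_of_le _ (by omega),
          ha.2, hb.2, sub_self]
        intro l hl
        rw [Finset.mem_range] at hl
        rw [if_neg (by omega)]

theorem IsBorel.mem_of_psum_le {d : ℕ} {B : Set (Fin n → ℤ)} (hB : IsBorel d B) {a b : Fin n → ℤ}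
    (ha : a ∈ B) (hb : b ∈ degSet n d) (h : ∀ i, psum a i ≤ psum b i) : b ∈ B :=
  hB.2 a ha b hb ((borelGE_iff (hB.1 ha) hb).2 h)

theorem psum_eq_of_le {d : ℕ} {a : Fin n → ℤ} (ha : a ∈ degSet n d) {i : ℕ} (hi : n ≤ i) :
    psum a i = d := by
  rw [psum_of_le a hi, ha.2]

theorem psum_le {d : ℕ} {a : Fin n → ℤ} (ha : a ∈ degSet n d) (i : ℕ) : psum a i ≤ d := by
  rw [← psum_eq_of_le ha (le_max_right i n)]
  exact psum_mono ha.1 (le_max_left i n)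

theorem ne_zero_of_mem_degSet {d : ℕ} (hd : 0 < d) {a : Fin n → ℤ} (ha : a ∈ degSet n d) :
    a ≠ 0 := by
  rintro rfl
  have := ha.2
  simp at this
  omega

theorem psum_eq_of_forall_gt {d : ℕ} {a b : Fin n → ℤ} (ha : a ∈ degSet n d) (hb : b ∈ degSet n d)
    {k : Fin n} (h : ∀ i, k < i → a i = b i) {i : ℕ} (hi : (k : ℕ) < i) : psum a i = psum b i := by
  have key : ∀ c ∈ degSet n d, psum c i + ∑ j ∈ Finset.univ.filter (fun j : Fin n => ¬ (j : ℕ) < i),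
      c j = d := by
    intro c hc
    rw [← hc.2]
    exact Finset.sum_filter_add_sum_filter_not _ _ _
  have h1 := key a ha
  have h2 := key b hb
  rw [Finset.sum_congr rfl fun j hj => h j ?_] at h1
  · linarith
  · simp only [Finset.mem_filter, Finset.mem_univ, true_and] at hj
    rw [Fin.lt_def]
    omega

/-! ### Gluing and truncation -/

/-- `glue w x y` has the coordinates of `x` before `w` and those of `y` after `w`; the coordinate in
place `w` is the one for which the partial sums are those of `x` up to `w` and those of `y`
afterwards. -/
def glue (w : Fin n) (x y : Fin n → ℤ) : Fin n → ℤ :=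
  fun i => if i < w then x i else if i = w then psum y (w + 1) - psum x w else y i

theorem glue_of_lt {w i : Fin n} (h : i < w) (x y : Fin n → ℤ) : glue w x y i = x i := by
  simp [glue, h]

theorem glue_self (w : Fin n) (x y : Fin n → ℤ) : glue w x y w = psum y (w + 1) - psum x w := by
  simp [glue]

theorem glue_of_gt {w i : Fin n} (h : w < i) (x y : Fin n → ℤ) : glue w x y i = y i := by
  simp [glue, h.ne', h.not_gt]

theorem psum_glue_of_le {w : Fin n} {i : ℕ} (hi : i ≤ w) (x y : Fin n → ℤ) :
    psum (glue w x y) i = psum x i :=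
  psum_congr (fun _ hj => glue_of_lt hj x y) hi

theorem psum_glue_of_gt {w : Fin n} {i : ℕ} (hi : (w : ℕ) < i) (x y : Fin n → ℤ) :
    psum (glue w x y) i = psum y i := by
  induction i, hi using Nat.le_induction with
  | base => rw [psum_succ, psum_glue_of_le le_rfl, glue_self]; ring
  | succ i hi ih =>
    rcases Nat.lt_or_ge i n with h | h
    · have h1 := psum_succ (glue w x y) ⟨i, h⟩
      have h2 := psum_succ y ⟨i, h⟩
      rw [glue_of_gt (by rw [Fin.lt_def]; exact hi)] at h1
      simp only at h1 h2
      rw [h1, h2, ih]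
    · rw [psum_of_le _ (by omega), psum_of_le _ (by omega)]
      rwa [psum_of_le _ h, psum_of_le _ h] at ih

theorem glue_mem_degSet {d : ℕ} {w : Fin n} {x y : Fin n → ℤ} (hx : x ∈ degSet n d)
    (hy : y ∈ degSet n d) (h : psum x w ≤ psum y (w + 1)) : glue w x y ∈ degSet n d := by
  refine ⟨fun i => ?_, ?_⟩
  · rcases lt_trichotomy i w with hi | rfl | hi
    · rw [glue_of_lt hi]; exact hx.1 i
    · rw [glue_self]; linarith
    · rw [glue_of_gt hi]; exact hy.1 i
  · rw [← psum_of_le _ le_rfl, psum_glue_of_gt w.2, psum_eq_of_le hy le_rfl]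

/-- The vector obtained from `a` by replacing all coordinates from place `k` on by `0`. -/
def trunc (k : ℕ) (a : Fin n → ℤ) : Fin n → ℤ := fun i => if (i : ℕ) < k then a i else 0

theorem trunc_eq_iff {k : ℕ} {a b : Fin n → ℤ} :
    trunc k a = trunc k b ↔ ∀ i : Fin n, (i : ℕ) < k → a i = b i := by
  constructor
  · intro h i hi
    have := congrFun h i
    simpa [trunc, hi] using this
  · intro h
    funext i
    by_cases hi : (i : ℕ) < k
    · simp [trunc, hi, h i hi]
    · simp [trunc, hi]

theorem psum_eq_of_trunc_eq {k : ℕ} {a b : Fin n → ℤ} (h : trunc k a = trunc k b) {i : ℕ}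
    (hi : i ≤ k) : psum a i = psum b i :=
  psum_congr (trunc_eq_iff.1 h) hi

theorem trunc_glue (w : Fin n) (x y : Fin n → ℤ) : trunc w (glue w x y) = trunc w x :=
  trunc_eq_iff.2 fun _ hi => glue_of_lt hi x y

theorem add_sub_eq_glue {d : ℕ} {k : Fin n} {a b c : Fin n → ℤ} (ha : a ∈ degSet n d)
    (hb : b ∈ degSet n d) (h : ∀ i, k < i → a i = b i) (hc : trunc k c = trunc k a) :
    c + (b - a) = glue k b c := by
  refine eq_of_psum_eq fun i _ => ?_
  rw [psum_add, psum_sub]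
  rcases Nat.lt_or_ge k i with hi | hi
  · rw [psum_glue_of_gt hi, psum_eq_of_forall_gt ha hb h hi]; ring
  · rw [psum_glue_of_le hi, psum_eq_of_trunc_eq hc hi]; ring

theorem exists_of_trunc_lt {k : ℕ} {a b : Fin n → ℤ} (h : toLex (trunc k a) < toLex (trunc k b)) :
    ∃ i : Fin n, (i : ℕ) < k ∧ (∀ j < i, a j = b j) ∧ a i < b i := by
  obtain ⟨i, h1, h2⟩ := h
  have hi : (i : ℕ) < k := by
    by_contra hi
    simp [trunc, hi] at h2
  refine ⟨i, hi, fun j hj => ?_, ?_⟩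
  · have := h1 j hj
    simpa [trunc, show (j : ℕ) < k from lt_trans hj hi] using this
  · simpa [trunc, hi] using h2

theorem lt_of_trunc_lt {k : ℕ} {a b : Fin n → ℤ} (h : toLex (trunc k a) < toLex (trunc k b)) :
    toLex a < toLex b := by
  obtain ⟨i, _, h1, h2⟩ := exists_of_trunc_lt h
  exact ⟨i, h1, h2⟩

theorem trunc_le_of_psum_le {k : ℕ} {a b : Fin n → ℤ} (h : ∀ i ≤ k, psum a i ≤ psum b i) :
    toLex (trunc k a) ≤ toLex (trunc k b) := by
  by_contra hlt
  obtain ⟨i, hi, h1, h2⟩ := exists_of_trunc_lt (not_le.1 hlt)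
  have h3 := psum_succ a i
  have h4 := psum_succ b i
  have h5 := h (i + 1) hi
  have h6 : psum b i = psum a i := psum_congr (k := i) (fun j hj => h1 j hj) le_rfl
  linarith

theorem trunc_le_of_lt {a b : Fin n → ℤ} (k : ℕ) (h : toLex a < toLex b) :
    toLex (trunc k a) ≤ toLex (trunc k b) := by
  by_contra hlt
  exact lt_asymm h (lt_of_trunc_lt (not_le.1 hlt))

/-! ### Cardinalities in a binomial system -/

theorem ncard_sep_union_translate {d : ℕ} {A C : Set (Fin n → ℤ)} {ρ : Fin n → ℤ}
    (h : IsBinomialSystem d A C ρ) {p : (Fin n → ℤ) → Prop} (hp : ∀ c ∈ C, p (c + ρ) ↔ p c) :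
    {c ∈ A ∪ translate C ρ | p c}.ncard = {c ∈ A ∪ C | p c}.ncard := by
  have hfin : ∀ S : Set (Fin n → ℤ), S ⊆ degSet n d → {c ∈ S | p c}.Finite :=
    fun S hS => (degSet_finite n d).subset fun c hc => hS hc.1
  have split : ∀ S : Set (Fin n → ℤ), S ⊆ degSet n d → A ∩ S = ∅ →
      {c ∈ A ∪ S | p c}.ncard = {c ∈ A | p c}.ncard + {c ∈ S | p c}.ncard := by
    intro S hS hAS
    rw [← Set.ncard_union_eq _ (hfin A h.left_subset) (hfin S hS)]
    · congr 1
      ext c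
      simp only [Set.mem_union, Set.mem_ofPred_eq]
      tauto
    · rw [Set.disjoint_iff_inter_eq_empty, Set.eq_empty_iff_forall_notMem]
      rintro c ⟨h1, h2⟩
      exact (Set.eq_empty_iff_forall_notMem.1 hAS c) ⟨h1.1, h2.1⟩
  rw [split _ h.translate_subset h.inter_translate, split _ h.right_subset h.inter_right]
  have : {c ∈ translate C ρ | p c} = (fun c => c + ρ) '' {c ∈ C | p c} := by
    ext c
    constructor
    · rintro ⟨⟨c, hc, rfl⟩, h2⟩
      exact ⟨c, ⟨hc, (hp c hc).1 h2⟩, rfl⟩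
    · rintro ⟨c, ⟨hc, h2⟩, rfl⟩
      exact ⟨⟨c, hc, rfl⟩, (hp c hc).2 h2⟩
  rw [this, Set.ncard_image_of_injective _ (add_left_injective ρ)]

variable [NeZero n]

/-! ### Extremal indices and the lexicographic order -/

theorem le_maxIdx {a : Fin n → ℤ} {i : Fin n} (h : a i ≠ 0) : i ≤ maxIdx a :=
  Finset.le_sup (f := id) (by simpa using h)

theorem eq_zero_of_maxIdx_lt {a : Fin n → ℤ} {i : Fin n} (h : maxIdx a < i) : a i = 0 := by
  by_contra h'
  exact absurd (le_maxIdx h') (not_le.2 h)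

theorem apply_maxIdx_ne_zero {a : Fin n → ℤ} (h : a ≠ 0) : a (maxIdx a) ≠ 0 := by
  obtain ⟨i, hi⟩ := Function.ne_iff.1 h
  have hne : (Finset.univ.filter fun i => a i ≠ 0).Nonempty := ⟨i, by simpa using hi⟩
  obtain ⟨j, hj, hj'⟩ := Finset.exists_mem_eq_sup _ hne id
  unfold maxIdx
  rw [hj']
  simpa using hj

theorem minIdx_le {a : Fin n → ℤ} {i : Fin n} (h : a i ≠ 0) : minIdx a ≤ i :=
  Finset.inf_le (f := id) (by simpa using h)

theorem apply_minIdx_ne_zero {a : Fin n → ℤ} (h : a ≠ 0) : a (minIdx a) ≠ 0 := by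
  obtain ⟨i, hi⟩ := Function.ne_iff.1 h
  have hne : (Finset.univ.filter fun i => a i ≠ 0).Nonempty := ⟨i, by simpa using hi⟩
  obtain ⟨j, hj, hj'⟩ := Finset.exists_mem_eq_inf _ hne id
  unfold minIdx
  rw [hj']
  simpa using hj

theorem maxIdx_eq_of {a : Fin n → ℤ} {i : Fin n} (h : a i ≠ 0) (h' : ∀ j, i < j → a j = 0) :
    maxIdx a = i := by
  refine le_antisymm ?_ (le_maxIdx h)
  by_contra hlt
  exact apply_maxIdx_ne_zero (fun h0 => h (by simp [h0])) (h' _ (not_le.1 hlt))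

theorem minIdx_eq_of {a : Fin n → ℤ} {i : Fin n} (h : a i ≠ 0) (h' : ∀ j, j < i → a j = 0) :
    minIdx a = i := by
  refine le_antisymm (minIdx_le h) ?_
  by_contra hlt
  exact apply_minIdx_ne_zero (fun h0 => h (by simp [h0])) (h' _ (not_le.1 hlt))

/-- `m(a)` can be read off the partial sums: it is the last place before which the sum is less than
the degree. -/
theorem psum_lt_iff {d : ℕ} (hd : 0 < d) {a : Fin n → ℤ} (ha : a ∈ degSet n d) (i : ℕ) :
    psum a i < d ↔ i ≤ maxIdx a := by
  have hpos : 0 < a (maxIdx a) :=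
    lt_of_le_of_ne (ha.1 _) (apply_maxIdx_ne_zero (ne_zero_of_mem_degSet hd ha)).symm
  constructor
  · intro h
    by_contra hi
    push Not at hi
    refine h.ne ?_
    rw [← ha.2]
    unfold psum
    refine Finset.sum_subset (Finset.subset_univ _) fun j _ hj => eq_zero_of_maxIdx_lt ?_
    simp only [Finset.mem_filter, Finset.mem_univ, true_and] at hj
    rw [Fin.lt_def]
    omega
  · intro h
    have h1 := psum_mono ha.1 h
    have h2 := psum_succ a (maxIdx a)
    have h3 := psum_le ha (maxIdx a + 1)
    linarith

theorem maxIdx_le_of_psum {d : ℕ} (hd : 0 < d) {a b : Fin n → ℤ} (ha : a ∈ degSet n d)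
    (hb : b ∈ degSet n d) (h : ∀ i, psum a i < d → psum b i < d) : maxIdx a ≤ maxIdx b :=
  (psum_lt_iff hd hb _).1 (h _ ((psum_lt_iff hd ha _).2 le_rfl))

/-- In a fixed degree, the homogeneous lexicographic order is the order of `Lex (Fin n → ℤ)`. -/
theorem hlexGT_iff {d : ℕ} {a b : Fin n → ℤ} (ha : a ∈ degSet n d) (hb : b ∈ degSet n d) :
    HlexGT a b ↔ toLex b < toLex a := by
  unfold HlexGT
  rw [ha.2, hb.2]
  simp only [lt_irrefl, false_or, true_and]
  constructor
  · intro h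
    refine ⟨minIdx (a - b), fun j hj => ?_, h⟩
    by_contra hne
    exact absurd (minIdx_le (a := a - b) (i := j) (sub_ne_zero.2 (Ne.symm hne))) (not_le.2 hj)
  · rintro ⟨i, h1, h2⟩
    have : minIdx (a - b) = i := minIdx_eq_of (sub_ne_zero.2 (ne_of_gt h2))
      fun j hj => sub_eq_zero.2 (h1 j hj).symm
    rw [this]
    exact h2

/-! ### Bad pairs and the construction of a Mall binomial system -/

/-- Within the vectors of degree `d` that share the index `m` and all coordinates from place `k` on,
the set `B` is closed under passing to lexicographically larger vectors. Places are counted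
from `0`. -/
def IsPrefixLex (d : ℕ) (B : Set (Fin n → ℤ)) (k : ℕ) : Prop :=
  ∀ x ∈ B, ∀ y ∈ degSet n d, maxIdx x = maxIdx y → (∀ i : Fin n, k ≤ i → x i = y i) →
    toLex x < toLex y → y ∈ B

/-- A Borel set with `IsPrefixLex` for `k` contains `y` already if `y` dominates an element `x` only
from place `k` on and is lexicographically larger than `x`: gluing the beginning of `x` to the end
of `y` gives an element of the set to which the defining property applies. -/
theorem IsPrefixLex.mem_of_psum_le {d : ℕ} (hd : 0 < d) {B : Set (Fin n → ℤ)} (hB : IsBorel d B)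
    {k : ℕ} (hk : k ≤ n) (H : IsPrefixLex d B k) {x y : Fin n → ℤ} (hx : x ∈ B)
    (hy : y ∈ degSet n d) (hlt : toLex x < toLex y) (hm : maxIdx y ≤ maxIdx x)
    (hP : ∀ i, k ≤ i → psum x i ≤ psum y i) : y ∈ B := by
  have hx' := hB.1 hx
  rcases Nat.eq_zero_or_pos k with rfl | hk0
  · exact hB.mem_of_psum_le hx hy fun i => hP i (Nat.zero_le i)
  -- `w = min (m(y), k - 1)` is the last place where `x` may be changed so that afterwards it agrees
  -- with `y` from place `k` on and has the same last nonzero coordinate as `y`.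
  obtain ⟨w, hwy, hwk, hw⟩ : ∃ w : Fin n, w ≤ maxIdx y ∧ (w : ℕ) < k ∧
      (w = maxIdx y ∨ (w : ℕ) + 1 = k) := by
    rcases Nat.lt_or_ge (maxIdx y) k with h | h
    · exact ⟨maxIdx y, le_rfl, h, Or.inl rfl⟩
    · refine ⟨⟨k - 1, by omega⟩, ?_, ?_, Or.inr ?_⟩
      · rw [Fin.le_def]; simp only; omega
      · simp only; omega
      · simp only; omega
  have hgt : ∀ i, (w : ℕ) < i → psum x i ≤ psum y i := by
    intro i hi
    rcases hw with rfl | hw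
    · have h1 : ¬ psum y i < d := by rw [psum_lt_iff hd hy]; omega
      exact (psum_le hx' i).trans (not_lt.1 h1)
    · exact hP i (by omega)
  have hz : glue w x y ∈ degSet n d :=
    glue_mem_degSet hx' hy ((psum_mono hx'.1 (Nat.le_succ w)).trans (hgt _ (Nat.lt_succ_self _)))
  have hzB : glue w x y ∈ B := by
    refine hB.mem_of_psum_le hx hz fun i => ?_
    rcases Nat.lt_or_ge w i with h | h
    · rw [psum_glue_of_gt h]; exact hgt i h
    · rw [psum_glue_of_le h]
  rcases (trunc_le_of_lt w hlt).lt_or_eq with h | h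
  · refine H _ hzB y hy ?_ ?_ (lt_of_trunc_lt (k := w) (by rwa [trunc_glue]))
    · have key : ∀ i, psum (glue w x y) i < d ↔ psum y i < d := by
        intro i
        rcases Nat.lt_or_ge w i with hi | hi
        · rw [psum_glue_of_gt hi]
        · rw [psum_glue_of_le hi, psum_lt_iff hd hx', psum_lt_iff hd hy]
          rw [Fin.le_def] at hwy hm
          omega
      exact le_antisymm (maxIdx_le_of_psum hd hz hy fun i => (key i).1)
        (maxIdx_le_of_psum hd hy hz fun i => (key i).2)
    · intro i hi
      exact glue_of_gt (by rw [Fin.lt_def]; omega) x y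
  · have : glue w x y = y := by
      refine eq_of_psum_eq fun i _ => ?_
      rcases Nat.lt_or_ge w i with hi | hi
      · rw [psum_glue_of_gt hi]
      · rw [psum_glue_of_le hi]
        exact psum_eq_of_trunc_eq h hi
    rwa [← this]

/-- The pair `(a, b)` violates `IsPrefixLex d B (k + 1)`: the vectors agree after place `k` and have
the same last nonzero coordinate, and the lexicographically larger one is not in `B`. -/
structure IsBadPair (d : ℕ) (B : Set (Fin n → ℤ)) (k : Fin n) (a b : Fin n → ℤ) : Prop where
  left_mem : a ∈ B
  right_mem : b ∈ degSet n d
  right_notMem : b ∉ B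
  maxIdx_eq : maxIdx a = maxIdx b
  eq_of_gt : ∀ i, k < i → a i = b i
  lt : toLex a < toLex b

theorem exists_isBadPair {d : ℕ} {B : Set (Fin n → ℤ)} {k : Fin n}
    (H : ¬ IsPrefixLex d B (k + 1)) : ∃ a b, IsBadPair d B k a b := by
  unfold IsPrefixLex at H
  push Not at H
  obtain ⟨a, ha, b, hb, h1, h2, h3, h4⟩ := H
  exact ⟨a, b, ha, hb, h4, h1, fun i hi => h2 i hi, h3⟩

/-- Among the bad pairs there is one for which the beginning of the first vector is
lexicographically as small as possible and then the beginning of the second one is as large as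
possible. -/
theorem exists_extremal_isBadPair {d : ℕ} {B : Set (Fin n → ℤ)} (hB : IsBorel d B) {k : Fin n}
    (H : ¬ IsPrefixLex d B (k + 1)) :
    ∃ a b, IsBadPair d B k a b ∧
      (∀ x y, IsBadPair d B k x y → ¬ toLex (trunc k x) < toLex (trunc k a)) ∧
      (∀ x y, IsBadPair d B k x y → trunc k x = trunc k a →
        ¬ toLex (trunc k b) < toLex (trunc k y)) := by
  let S : Set ((Fin n → ℤ) × (Fin n → ℤ)) := {p | IsBadPair d B k p.1 p.2}
  have hS : S.Finite := ((degSet_finite n d).prod (degSet_finite n d)).subset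
    fun p hp => ⟨hB.1 hp.left_mem, hp.right_mem⟩
  obtain ⟨a, b, hab⟩ := exists_isBadPair H
  let f : (Fin n → ℤ) × (Fin n → ℤ) → (Lex (Fin n → ℤ)) ×ₗ (Lex (Fin n → ℤ))ᵒᵈ :=
    fun p => toLex (toLex (trunc k p.1), OrderDual.toDual (toLex (trunc k p.2)))
  obtain ⟨p, hp, hmin⟩ := Set.exists_min_image S f hS ⟨(a, b), hab⟩
  refine ⟨p.1, p.2, hp, fun x y hxy hlt => ?_, fun x y hxy heq hlt => ?_⟩
  · refine not_lt.2 (hmin (x, y) hxy) (Prod.Lex.toLex_lt_toLex.2 (Or.inl hlt))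
  · refine not_lt.2 (hmin (x, y) hxy) (Prod.Lex.toLex_lt_toLex.2 (Or.inr ⟨?_, hlt⟩))
    exact congrArg toLex heq

/-- Vectors with the same partial sums beyond place `k`, neither of which reaches the full degree
before place `k`, have the same last nonzero coordinate. -/
theorem maxIdx_eq_of_psum_eq {d : ℕ} (hd : 0 < d) {a b : Fin n → ℤ} (ha : a ∈ degSet n d)
    (hb : b ∈ degSet n d) {k : Fin n} (h : ∀ i, (k : ℕ) < i → psum a i = psum b i)
    (hak : psum a k < d) (hbk : psum b k < d) : maxIdx a = maxIdx b := by
  have key : ∀ i, psum a i < d ↔ psum b i < d := by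
    intro i
    rcases Nat.lt_or_ge k i with hi | hi
    · rw [h i hi]
    · exact iff_of_true ((psum_mono ha.1 hi).trans_lt hak) ((psum_mono hb.1 hi).trans_lt hbk)
  exact le_antisymm (maxIdx_le_of_psum hd ha hb fun i => (key i).1)
    (maxIdx_le_of_psum hd hb ha fun i => (key i).2)

/-- If `B` satisfies `IsPrefixLex` for `k`, then the sum of the coordinates before place `k` drops
in a bad pair at `k`, so that the coordinate in place `k` grows. -/
theorem IsBadPair.psum_lt {d : ℕ} (hd : 0 < d) {B : Set (Fin n → ℤ)} (hB : IsBorel d B) {k : Fin n}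
    (H : IsPrefixLex d B k) {a b : Fin n → ℤ} (h : IsBadPair d B k a b) :
    psum b k < psum a k := by
  by_contra hlt
  refine h.right_notMem (H.mem_of_psum_le hd hB k.2.le h.left_mem h.right_mem h.lt
    h.maxIdx_eq.ge fun i hi => ?_)
  rcases hi.eq_or_lt with rfl | hi
  · exact not_lt.1 hlt
  · exact (psum_eq_of_forall_gt (hB.1 h.left_mem) h.right_mem h.eq_of_gt hi).le

theorem IsBadPair.trunc_lt {d : ℕ} (hd : 0 < d) {B : Set (Fin n → ℤ)} (hB : IsBorel d B)
    {k : Fin n} (H : IsPrefixLex d B k) {a b : Fin n → ℤ} (h : IsBadPair d B k a b) :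
    toLex (trunc k a) < toLex (trunc k b) := by
  refine lt_of_le_of_ne (trunc_le_of_lt k h.lt) fun heq => ?_
  exact (h.psum_lt hd hB H).ne' (psum_eq_of_trunc_eq (toLex.injective heq) le_rfl)

theorem IsBadPair.psum_lt_degree {d : ℕ} (hd : 0 < d) {B : Set (Fin n → ℤ)} (hB : IsBorel d B)
    {k : Fin n} (H : IsPrefixLex d B k) {a b : Fin n → ℤ} (h : IsBadPair d B k a b) :
    psum a k < d := by
  rw [psum_lt_iff hd (hB.1 h.left_mem), h.maxIdx_eq, ← psum_lt_iff hd h.right_mem]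
  exact (h.psum_lt hd hB H).trans_le (psum_le (hB.1 h.left_mem) k)

theorem isPrefixLex_zero (d : ℕ) (B : Set (Fin n → ℤ)) : IsPrefixLex d B 0 := by
  intro x _ y _ _ h hlt
  exact absurd (congrArg toLex (funext fun i => h i (Nat.zero_le _))) hlt.ne

/-- Two vectors agreeing from place `n - 1` on, counted from `0`, are ones with the same last
coordinate. -/
theorem isGrowthHeightLex_of_isPrefixLex {d : ℕ} {B : Set (Fin n → ℤ)} (hB : IsBorel d B)
    (H : IsPrefixLex d B (n - 1)) : IsGrowthHeightLex d B := by
  have key : ∀ x ∈ B, ∀ y ∈ degSet n d, HlexGT y x → maxIdx x = maxIdx y → x ⊤ = y ⊤ → y ∈ B := by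
    intro x hx y hy hgt hm htop
    refine H x hx y hy hm (fun i hi => ?_) ((hlexGT_iff hy (hB.1 hx)).1 hgt)
    have : i = ⊤ := by
      refine top_unique ?_
      rw [Fin.le_def]
      have := (⊤ : Fin n).2
      omega
    rw [this, htop]
  refine ⟨fun i hi => ⟨fun a ha => ⟨hB.1 ha.1, ha.2⟩, ?_⟩,
    fun i hi _ => ⟨fun a ha => ⟨hB.1 ha.1, ha.2⟩, ?_⟩⟩
  · rintro a ⟨ha, hai⟩ b ⟨hb, hbi⟩ hgt
    refine ⟨key a ha b hb hgt (hai.trans hbi.symm) ?_, hbi⟩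
    rw [eq_zero_of_maxIdx_lt (a := a) (hai.trans_lt hi),
      eq_zero_of_maxIdx_lt (a := b) (hbi.trans_lt hi)]
  · rintro a ⟨ha, hai⟩ b ⟨hb, hbi⟩ hgt
    have top : ∀ c : Fin n → ℤ, c ⊤ = i → maxIdx c = ⊤ := fun c hc =>
      top_unique (le_maxIdx (by rw [hc]; exact_mod_cast (by omega)))
    exact ⟨key a ha b hb hgt ((top a hai).trans (top b hbi).symm) (hai.trans hbi.symm), hbi⟩

/-- A Borel set for which `IsPrefixLex` holds at `k` but not at `k + 1` is the source of a
nontrivial Mall binomial system moving only coordinates up to place `k`. Take the extremal bad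
pair `(a, b)` and `ρ = b - a`; the elements moved are those that begin like `a` and leave the set
under the translation. -/
theorem exists_isMall_of_not_isPrefixLex {d : ℕ} (hd : 0 < d) {B : Set (Fin n → ℤ)}
    (hB : IsBorel d B) {k : Fin n} (H : IsPrefixLex d B k) (H' : ¬ IsPrefixLex d B (k + 1)) :
    ∃ (A C : Set (Fin n → ℤ)) (ρ : Fin n → ℤ), IsMall d A C ρ ∧ B = A ∪ C ∧ C.Nonempty ∧
      maxIdx ρ = k := by
  obtain ⟨a, b, hab, hmin, hmax⟩ := exists_extremal_isBadPair hB H'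
  have ha := hB.1 hab.left_mem
  have hb := hab.right_mem
  have hps := hab.psum_lt hd hB H
  have htr := hab.trunc_lt hd hB H
  have hdeg := hab.psum_lt_degree hd hB H
  have hpos : 0 < (b - a) k := by
    have h1 := psum_succ a k
    have h2 := psum_succ b k
    have h3 := psum_eq_of_forall_gt ha hb hab.eq_of_gt (Nat.lt_succ_self k)
    rw [Pi.sub_apply]
    linarith
  have hmaxρ : maxIdx (b - a) = k :=
    maxIdx_eq_of hpos.ne' fun j hj => sub_eq_zero.2 (hab.eq_of_gt j hj).symm
  have hglue : ∀ c, trunc k c = trunc k a → c + (b - a) = glue k b c :=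
    fun c hc => add_sub_eq_glue ha hb hab.eq_of_gt hc
  have hglue_mem : ∀ c ∈ degSet n d, trunc k c = trunc k a → glue k b c ∈ degSet n d := by
    intro c hc hca
    refine glue_mem_degSet hb hc ?_
    have h1 := psum_eq_of_trunc_eq hca le_rfl
    have h2 := psum_mono hc.1 (Nat.le_succ k)
    simp only [Nat.succ_eq_add_one] at h2
    linarith
  let C : Set (Fin n → ℤ) := {c | c ∈ B ∧ trunc k c = trunc k a ∧ glue k b c ∉ B}
  have hCB : C ⊆ B := fun c hc => hc.1
  have htrans : translate C (b - a) = (glue k b) '' C :=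
    Set.image_congr fun c hc => hglue c hc.2.1
  have hmaxC : ∀ c ∈ C, maxIdx c = maxIdx (glue k b c) := by
    intro c hc
    refine maxIdx_eq_of_psum_eq (k := k) hd (hB.1 hc.1) (hglue_mem c (hB.1 hc.1) hc.2.1)
      (fun i hi => (psum_glue_of_gt hi b c).symm) ?_ ?_
    · rwa [psum_eq_of_trunc_eq hc.2.1 le_rfl]
    · rw [psum_glue_of_le le_rfl]
      exact hps.trans hdeg
  -- Elements of `B` below an element of `C` lie in `C`.
  have hdown : ∀ c ∈ C, ∀ x ∈ B, (∀ i, psum x i ≤ psum c i) → x ∈ C := by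
    intro c hc x hx hxc
    have hx' := hB.1 hx
    have hc' := hB.1 hc.1
    have hgc := hglue_mem c hc' hc.2.1
    rcases (trunc_le_of_psum_le (k := k) fun i _ => hxc i).lt_or_eq with hlt | heq
    · exfalso
      rw [hc.2.1] at hlt
      have hlt' : toLex (trunc k x) < toLex (trunc k (glue k b c)) := by
        rw [trunc_glue]; exact hlt.trans htr
      have hge : ¬ psum x k ≤ psum (glue k b c) k := by
        intro hle
        refine hc.2.2 (H.mem_of_psum_le hd hB k.2.le hx hgc (lt_of_trunc_lt hlt') ?_
          fun i hi => ?_)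
        · rw [← hmaxC c hc]
          exact maxIdx_le_of_psum hd hc' hx' fun i hi => (hxc i).trans_lt hi
        · rcases hi.eq_or_lt with rfl | hi
          · exact hle
          · rw [psum_glue_of_gt hi]; exact hxc i
      rw [psum_glue_of_le le_rfl, not_le] at hge
      have hz : glue k b x ∈ degSet n d :=
        glue_mem_degSet hb hx' (hge.le.trans (psum_mono hx'.1 (Nat.le_succ k)))
      -- `(x, glue k b x)` is a bad pair whose first vector begins with something smaller than `a`.
      refine hmin x (glue k b x) ⟨hx, hz, fun hzB => hc.2.2 ?_, ?_, ?_, ?_⟩ hlt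
      · refine hB.mem_of_psum_le hzB hgc fun i => ?_
        rcases Nat.lt_or_ge k i with hi | hi
        · rw [psum_glue_of_gt hi, psum_glue_of_gt hi]; exact hxc i
        · rw [psum_glue_of_le hi, psum_glue_of_le hi]
      · refine maxIdx_eq_of_psum_eq (k := k) hd hx' hz
          (fun i hi => (psum_glue_of_gt hi b x).symm) ?_ ?_
        · refine (hxc k).trans_lt ?_
          rwa [psum_eq_of_trunc_eq hc.2.1 le_rfl]
        · rw [psum_glue_of_le le_rfl]
          exact hps.trans hdeg
      · exact fun i hi => (glue_of_gt hi b x).symm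
      · exact lt_of_trunc_lt (k := k) (by rw [trunc_glue]; exact hlt.trans htr)
    · refine ⟨hx, (toLex.injective heq).trans hc.2.1, fun hgx => hc.2.2 ?_⟩
      refine hB.mem_of_psum_le hgx hgc fun i => ?_
      rcases Nat.lt_or_ge k i with hi | hi
      · rw [psum_glue_of_gt hi, psum_glue_of_gt hi]; exact hxc i
      · rw [psum_glue_of_le hi, psum_glue_of_le hi]
  -- Vectors above an element of the translate lie in `B \ C` or in the translate.
  have hup : ∀ c ∈ C, ∀ y ∈ degSet n d, (∀ i, psum (glue k b c) i ≤ psum y i) →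
      y ∈ (B \ C) ∪ (glue k b) '' C := by
    intro c hc y hy hcy
    have hc' := hB.1 hc.1
    have hgc := hglue_mem c hc' hc.2.1
    have hle := trunc_le_of_psum_le (k := k) fun i _ => hcy i
    rw [trunc_glue] at hle
    have hnC : y ∉ C := fun h => (htr.trans_le hle).ne' (congrArg toLex h.2.1)
    by_cases hyB : y ∈ B
    · exact Or.inl ⟨hyB, hnC⟩
    have hgt : ∀ i, (k : ℕ) < i → psum c i ≤ psum y i := by
      intro i hi
      rw [← psum_glue_of_gt hi b c]
      exact hcy i
    rcases hle.lt_or_eq with hlt | heq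
    · exfalso
      have hca : toLex (trunc k c) = toLex (trunc k a) := congrArg toLex hc.2.1
      have hge : ¬ psum c k ≤ psum y k := by
        intro hle
        refine hyB (H.mem_of_psum_le hd hB k.2.le hc.1 hy
          (lt_of_trunc_lt (hca.trans_lt (htr.trans hlt))) ?_ fun i hi => ?_)
        · rw [hmaxC c hc]
          exact maxIdx_le_of_psum hd hy hgc fun i hi => (hcy i).trans_lt hi
        · rcases hi.eq_or_lt with rfl | hi
          · exact hle
          · exact hgt i hi
      have hck : psum c k < d := by rwa [psum_eq_of_trunc_eq hc.2.1 le_rfl]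
      have hz : glue k c y ∈ degSet n d := glue_mem_degSet hc' hy
        ((psum_mono hc'.1 (Nat.le_succ k)).trans (hgt _ (Nat.lt_succ_self k)))
      -- `(glue k c y, y)` is a bad pair beginning with `a` and with something larger than `b`.
      refine hmax (glue k c y) y ⟨?_, hy, hyB, ?_, ?_, ?_⟩ ((trunc_glue k c y).trans hc.2.1) hlt
      · refine hB.mem_of_psum_le hc.1 hz fun i => ?_
        rcases Nat.lt_or_ge k i with hi | hi
        · rw [psum_glue_of_gt hi]; exact hgt i hi
        · rw [psum_glue_of_le hi]
      · refine maxIdx_eq_of_psum_eq (k := k) hd hz hy (fun i hi => psum_glue_of_gt hi c y) ?_ ?_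
        · rwa [psum_glue_of_le le_rfl]
        · exact (not_le.1 hge).trans hck
      · exact fun i hi => glue_of_gt hi c y
      · exact lt_of_trunc_lt (k := k) (by rw [trunc_glue, hca]; exact htr.trans hlt)
    · -- `glue k a y` is `y - ρ`.
      have heq' : trunc k b = trunc k y := toLex.injective heq
      have hak : ∀ i ≤ (k : ℕ), psum c i = psum a i := fun i hi => psum_eq_of_trunc_eq hc.2.1 hi
      have hz : glue k a y ∈ degSet n d := by
        refine glue_mem_degSet ha hy ?_
        rw [← hak k le_rfl]
        exact (psum_mono hc'.1 (Nat.le_succ k)).trans (hgt _ (Nat.lt_succ_self k))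
      have hback : glue k b (glue k a y) = y := by
        refine eq_of_psum_eq fun i _ => ?_
        rcases Nat.lt_or_ge k i with hi | hi
        · rw [psum_glue_of_gt hi, psum_glue_of_gt hi]
        · rw [psum_glue_of_le hi, psum_eq_of_trunc_eq heq' hi]
      refine Or.inr ⟨glue k a y, ⟨?_, trunc_glue k a y, by rwa [hback]⟩, hback⟩
      refine hB.mem_of_psum_le hc.1 hz fun i => ?_
      rcases Nat.lt_or_ge k i with hi | hi
      · rw [psum_glue_of_gt hi]; exact hgt i hi
      · rw [psum_glue_of_le hi, hak i hi]
  have hdisj : ∀ c ∈ C, glue k b c ∉ B := fun c hc => hc.2.2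
  have htsub : (glue k b) '' C ⊆ degSet n d := by
    rintro _ ⟨c, hc, rfl⟩
    exact hglue_mem c (hB.1 hc.1) hc.2.1
  refine ⟨B \ C, C, b - a, ?_, (Set.sdiff_union_of_subset hCB).symm,
    ⟨a, hab.left_mem, rfl, ?_⟩, hmaxρ⟩
  · refine
      { left_subset := fun x hx => hB.1 hx.1
        right_subset := fun x hx => hB.1 hx.1
        translate_subset := htrans ▸ htsub
        inter_right := Set.sdiff_inter_self
        inter_translate := ?_
        right_inter_translate := ?_
        borel_right := by rwa [Set.sdiff_union_of_subset hCB]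
        borel_translate := ?_
        eq_empty_or_pos := Or.inr (by rwa [hmaxρ])
        eq_of_lt := ?_
        minIdx_pos := ?_
        maxIdx_eq := fun c hc => by rw [hglue c hc.2.1]; exact hmaxC c hc }
    · rw [htrans, Set.eq_empty_iff_forall_notMem]
      rintro _ ⟨hx, c, hc, rfl⟩
      exact hdisj c hc hx.1
    · rw [htrans, Set.eq_empty_iff_forall_notMem]
      rintro _ ⟨hx, c, hc, rfl⟩
      exact hdisj c hc hx.1
    · rw [htrans]
      refine ⟨Set.union_subset (fun x hx => hB.1 hx.1) htsub, ?_⟩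
      rintro x hx y hy hyx
      rcases hx with hx | ⟨c, hc, rfl⟩
      · rw [borelGE_iff (hB.1 hx.1) hy] at hyx
        exact Or.inl ⟨hB.mem_of_psum_le hx.1 hy hyx, fun hyC => hx.2 (hdown y hyC x hx.1 hyx)⟩
      · rw [borelGE_iff (hglue_mem c (hB.1 hc.1) hc.2.1) hy] at hyx
        exact hup c hc y hy hyx
    · intro i hi x hx y hy
      rw [hmaxρ] at hi
      exact trunc_eq_iff.1 (hx.2.1.trans hy.2.1.symm) i hi
    · obtain ⟨i, h1, h2⟩ := hab.lt
      have h3 : a i < b i := h2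
      have : minIdx (b - a) = i := minIdx_eq_of (sub_ne_zero.2 h3.ne')
        fun j hj => sub_eq_zero.2 (h1 j hj).symm
      rw [this]
      exact sub_pos.2 h3
  · rw [← hglue a rfl, add_sub_cancel]; exact hab.right_notMem

/-! ### Effect of a Mall binomial system -/

theorem IsMall.growthVec_eq {d : ℕ} {A C : Set (Fin n → ℤ)} {ρ : Fin n → ℤ} (h : IsMall d A C ρ) :
    growthVec (A ∪ translate C ρ) = growthVec (A ∪ C) :=
  funext fun _ => ncard_sep_union_translate h.toIsBinomialSystem
    fun c hc => by rw [h.maxIdx_eq c hc]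

theorem IsMall.heightVec_eq {d : ℕ} {A C : Set (Fin n → ℤ)} {ρ : Fin n → ℤ} (h : IsMall d A C ρ)
    (hρ : maxIdx ρ < ⊤) : heightVec d (A ∪ translate C ρ) = heightVec d (A ∪ C) :=
  funext fun _ => ncard_sep_union_translate h.toIsBinomialSystem
    fun c _ => by rw [Pi.add_apply, eq_zero_of_maxIdx_lt hρ, add_zero]

/-- The sum, over the elements `c` of `B`, of the number of vectors of degree `d` that are
lexicographically larger than `c`. It measures the progress towards the normal form. -/
noncomputable def lexDeficiency (d : ℕ) (B : Set (Fin n → ℤ)) : ℕ :=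
  ∑ᶠ c ∈ B, {x ∈ degSet n d | toLex c < toLex x}.ncard

theorem IsMall.lt_translate {d : ℕ} {A C : Set (Fin n → ℤ)} {ρ : Fin n → ℤ} (h : IsMall d A C ρ)
    (c : Fin n → ℤ) : toLex c < toLex (c + ρ) := by
  refine ⟨minIdx ρ, fun j hj => ?_, ?_⟩
  · have : ρ j = 0 := by
      by_contra h0
      exact absurd (minIdx_le h0) (not_le.2 hj)
    change c j = c j + ρ j
    rw [this, add_zero]
  · have := h.minIdx_pos
    change c (minIdx ρ) < c (minIdx ρ) + ρ (minIdx ρ)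
    linarith

theorem IsMall.lexDeficiency_lt {d : ℕ} {A C : Set (Fin n → ℤ)} {ρ : Fin n → ℤ}
    (h : IsMall d A C ρ) (hC : C.Nonempty) :
    lexDeficiency d (A ∪ translate C ρ) < lexDeficiency d (A ∪ C) := by
  have hfin : ∀ S : Set (Fin n → ℤ), S ⊆ degSet n d → S.Finite :=
    fun S hS => (degSet_finite n d).subset hS
  have hCf := hfin C h.right_subset
  unfold lexDeficiency
  rw [finsum_mem_union (Set.disjoint_iff_inter_eq_empty.2 h.inter_translate)
      (hfin A h.left_subset) (hfin _ h.translate_subset),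
    finsum_mem_union (Set.disjoint_iff_inter_eq_empty.2 h.inter_right) (hfin A h.left_subset) hCf]
  refine Nat.add_lt_add_left ?_ _
  unfold translate
  rw [finsum_mem_image (add_left_injective ρ).injOn,
    finsum_mem_eq_finite_toFinset_sum _ hCf, finsum_mem_eq_finite_toFinset_sum _ hCf]
  refine Finset.sum_lt_sum_of_nonempty (by simpa using hC) fun c hc => ?_
  rw [Set.Finite.mem_toFinset] at hc
  refine Set.ncard_lt_ncard ⟨fun x hx => ⟨hx.1, (h.lt_translate c).trans hx.2⟩, fun hsub => ?_⟩
    ((degSet_finite n d).subset fun x hx => hx.1)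
  exact lt_irrefl _ (hsub ⟨h.translate_subset ⟨c, hc, rfl⟩, h.lt_translate c⟩).2

/-! ### Uniqueness of the normal form -/

theorem IsLexSegment.eq_of_ncard_eq {d : ℕ} {S T U : Set (Fin n → ℤ)} (hU : U ⊆ degSet n d)
    (hS : IsLexSegment S U) (hT : IsLexSegment T U) (h : S.ncard = T.ncard) : S = T := by
  have hSf : S.Finite := (degSet_finite n d).subset (hS.1.trans hU)
  have hTf : T.Finite := (degSet_finite n d).subset (hT.1.trans hU)
  by_cases hST : S ⊆ T
  · exact Set.eq_of_subset_of_ncard_le hST h.ge hTf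
  · obtain ⟨s, hs, hsT⟩ := Set.not_subset.1 hST
    refine (Set.eq_of_subset_of_ncard_le (fun t ht => ?_) h.le hSf).symm
    have hs' := hU (hS.1 hs)
    have ht' := hU (hT.1 ht)
    rcases lt_trichotomy (toLex s) (toLex t) with hlt | heq | hlt
    · exact hS.2 s hs t (hT.1 ht) ((hlexGT_iff ht' hs').2 hlt)
    · rwa [← toLex.injective heq]
    · exact absurd (hT.2 t ht s (hS.1 hs) ((hlexGT_iff hs' ht').2 hlt)) hsT

theorem IsNormalForm.subset {d : ℕ} (hd : 0 < d) {B L L' : Set (Fin n → ℤ)}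
    (h : IsNormalForm d B L) (h' : IsNormalForm d B L') : L ⊆ L' := by
  obtain ⟨hL, hlex, hg, hh⟩ := h
  obtain ⟨_, hlex', hg', hh'⟩ := h'
  intro c hc
  have hc' := hL.1 hc
  rcases lt_or_eq_of_le (le_top : maxIdx c ≤ ⊤) with hlt | htop
  · have := (hlex.1 _ hlt).eq_of_ncard_eq (d := d) (fun x hx => hx.1) (hlex'.1 _ hlt)
      (congrFun (hg.trans hg'.symm) (maxIdx c))
    have hmem : c ∈ growthPart L (maxIdx c) := ⟨hc, rfl⟩
    rw [this] at hmem
    exact hmem.1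
  · have hne := apply_maxIdx_ne_zero (ne_zero_of_mem_degSet hd hc')
    rw [htop] at hne
    obtain ⟨i, hi⟩ := Int.eq_ofNat_of_zero_le (hc'.1 ⊤)
    have hle : c ⊤ ≤ d := by
      rw [← hc'.2]
      exact Finset.single_le_sum (fun j _ => hc'.1 j) (Finset.mem_univ _)
    have h1 : 1 ≤ i := by omega
    have h2 : i ≤ d := by omega
    have hcard := congrFun (hh.trans hh'.symm) ⟨i - 1, by omega⟩
    simp only [heightVec, Nat.sub_add_cancel h1] at hcard
    have := (hlex.2 i h1 h2).eq_of_ncard_eq (d := d) (fun x hx => hx.1) (hlex'.2 i h1 h2) hcard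
    have hmem : c ∈ heightPart L i := ⟨hc, hi⟩
    rw [this] at hmem
    exact hmem.1

theorem IsNormalForm.unique {d : ℕ} (hd : 0 < d) {B L L' : Set (Fin n → ℤ)}
    (h : IsNormalForm d B L) (h' : IsNormalForm d B L') : L = L' :=
  (h.subset hd h').antisymm (h'.subset hd h)

/-! ### Existence of the normal form and the chain -/

/-- `B'` arises from `B` by the translation of a Mall binomial system that fixes the last
coordinate. -/
def MallStep (d : ℕ) (B B' : Set (Fin n → ℤ)) : Prop :=
  ∃ (A C : Set (Fin n → ℤ)) (ρ : Fin n → ℤ), IsMall d A C ρ ∧ B = A ∪ C ∧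
    B' = A ∪ translate C ρ ∧ maxIdx ρ < ⊤

/-- The least `k` for which `IsPrefixLex` fails gives a step that keeps both vectors. -/
theorem exists_mallStep {d : ℕ} (hd : 0 < d) {B : Set (Fin n → ℤ)} (hB : IsBorel d B)
    (h : ¬ IsGrowthHeightLex d B) : ∃ B', MallStep d B B' ∧ IsBorel d B' ∧
      growthVec B' = growthVec B ∧ heightVec d B' = heightVec d B ∧
      lexDeficiency d B' < lexDeficiency d B := by
  have hnot : ∃ k, ¬ IsPrefixLex d B k :=
    ⟨n - 1, fun H => h (isGrowthHeightLex_of_isPrefixLex hB H)⟩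
  classical
  have hle : Nat.find hnot ≤ n - 1 :=
    Nat.find_min' hnot fun H => h (isGrowthHeightLex_of_isPrefixLex hB H)
  obtain ⟨k, hk⟩ : ∃ k, Nat.find hnot = k + 1 :=
    Nat.exists_eq_succ_of_ne_zero fun h0 => Nat.find_spec hnot (h0 ▸ isPrefixLex_zero d B)
  have hkn : k < n := by omega
  obtain ⟨A, C, ρ, hM, rfl, hC, hρ⟩ := exists_isMall_of_not_isPrefixLex hd hB (k := ⟨k, hkn⟩)
    (not_not.1 (Nat.find_min hnot (m := k) (by omega))) (hk ▸ Nat.find_spec hnot)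
  have hlt : maxIdx ρ < ⊤ := by
    have h1 : (⟨n - 1, by omega⟩ : Fin n) ≤ ⊤ := le_top
    rw [hρ, Fin.lt_def]
    rw [Fin.le_def] at h1
    simp only at h1 ⊢
    omega
  exact ⟨_, ⟨A, C, ρ, hM, rfl, rfl, hlt⟩, hM.borel_translate, hM.growthVec_eq,
    hM.heightVec_eq hlt, hM.lexDeficiency_lt hC⟩

theorem exists_isNormalForm {d : ℕ} (hd : 0 < d) (B : Set (Fin n → ℤ)) (hB : IsBorel d B) :
    ∃ L, IsNormalForm d B L ∧ Relation.ReflTransGen (MallStep d) B L := by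
  by_cases h : IsGrowthHeightLex d B
  · exact ⟨B, ⟨hB, h, rfl, rfl⟩, Relation.ReflTransGen.refl⟩
  · obtain ⟨B', hstep, hB', hg, hh, hlt⟩ := exists_mallStep hd hB h
    obtain ⟨L, ⟨h1, h2, h3, h4⟩, hL⟩ := exists_isNormalForm hd B' hB'
    exact ⟨L, ⟨h1, h2, h3.trans hg, h4.trans hh⟩, hL.head hstep⟩
termination_by lexDeficiency d B

/-- A nonempty chain of steps, written as a sequence of Mall binomial systems. -/
theorem exists_sequence_of_transGen {d : ℕ} {B L : Set (Fin n → ℤ)}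
    (h : Relation.TransGen (MallStep d) B L) :
    ∃ (r : ℕ) (A C : Fin (r + 1) → Set (Fin n → ℤ)) (ρ : Fin (r + 1) → Fin n → ℤ),
      (∀ i, IsMall d (A i) (C i) (ρ i)) ∧
      B = A 0 ∪ C 0 ∧
      (∀ i : Fin r, A i.castSucc ∪ translate (C i.castSucc) (ρ i.castSucc) =
        A i.succ ∪ C i.succ) ∧
      L = A (Fin.last r) ∪ translate (C (Fin.last r)) (ρ (Fin.last r)) ∧
      ∀ i, maxIdx (ρ i) < ⊤ := by
  induction h using Relation.TransGen.head_induction_on with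
  | single h =>
    obtain ⟨A, C, ρ, hM, hB, hL, hρ⟩ := h
    exact ⟨0, fun _ => A, fun _ => C, fun _ => ρ, fun _ => hM, hB, fun i => i.elim0, hL,
      fun _ => hρ⟩
  | head h _ ih =>
    obtain ⟨A, C, ρ, hM, hB, hB', hρ⟩ := h
    obtain ⟨r, A', C', ρ', h1, h2, h3, h4, h5⟩ := ih
    refine ⟨r + 1, Fin.cons A A', Fin.cons C C', Fin.cons ρ ρ', fun i => ?_, hB, fun i => ?_, ?_,
      fun i => ?_⟩
    · refine Fin.cases hM (fun j => ?_) i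
      exact h1 j
    · refine Fin.cases (hB'.symm.trans h2) (fun j => ?_) i
      exact h3 j
    · exact h4
    · refine Fin.cases hρ (fun j => ?_) i
      exact h5 j

end

end BorelSets

theorem mainTheorem10 (n d : ℕ) [NeZero n] (hd : 0 < d)
    (B : Set (Fin n → ℤ)) (hB : BorelSets.IsBorel d B) :
    (∃! L : Set (Fin n → ℤ), BorelSets.IsNormalForm d B L) ∧
    ∀ L : Set (Fin n → ℤ), BorelSets.IsNormalForm d B L → B ≠ L →
      ∃ (r : ℕ) (A C : Fin (r + 1) → Set (Fin n → ℤ)) (ρ : Fin (r + 1) → Fin n → ℤ),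
        (∀ i, BorelSets.IsMall d (A i) (C i) (ρ i)) ∧
        B = A 0 ∪ C 0 ∧
        (∀ i : Fin r, A i.castSucc ∪ BorelSets.translate (C i.castSucc) (ρ i.castSucc) =
          A i.succ ∪ C i.succ) ∧
        L = A (Fin.last r) ∪ BorelSets.translate (C (Fin.last r)) (ρ (Fin.last r)) ∧
        ∀ i, BorelSets.maxIdx (ρ i) < ⊤ := by
  obtain ⟨L₀, hL₀, hchain⟩ := BorelSets.exists_isNormalForm hd B hB
  refine ⟨⟨L₀, hL₀, fun L hL => hL.unique hd hL₀⟩, fun L hL hne => ?_⟩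
  obtain rfl := hL.unique hd hL₀
  rcases Relation.reflTransGen_iff_eq_or_transGen.1 hchain with h | h
  · exact absurd h.symm hne
  · exact BorelSets.exists_sequence_of_transGen h
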